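/- Conventions. For $Y\subseteq\mathbb{R}^d$ (with the Euclidean metric) and $s\ge 0$ let $Y^s=\{p\in\mathbb{R}^d \mid \exists y\in Y,\ \|p-y\|\le s\}$, and let $\operatorname{Unp}(Y)$ be the set of points of $\mathbb{R}^d$ that have a unique nearest point in $Y$. The reach of $Y$ is $\tau(Y)=\sup\{s\ge 0\mid Y^s\subseteq\operatorname{Unp}(Y)\}\in[0,\infty]$. For a topological space $Y$ and a continuous $f:Y\to\mathbb{R}$, the Reeb graph $\operatorname{Rb}(Y,f)$ is the quotient space of $Y$ in which two points are identified when they lie in the same connected component of the same level set of $f$, together with the induced continuous function $\tilde f([y])=f(y)$. The Reeb precosheaf $\mathcal{D}(Y,f)$ is the functor from the poset of (nonempty) open intervals of $\mathbb{R}$, ordered by inclusion, to sets that sends $I$ to the set of connected components of $f^{-1}(I)$. For $s\ge 0$ let $\omega_s(a,b)=(a-s,b+s)$. Two such functors $C,D$ are $s$-interleaved if there are natural transformations $\Phi:C\to D\circ\omega_s$ and $\Psi:D\to C\circ\omega_s$ with $\Psi_{\omega_s(I)}\circ\Phi_I=C(I\subseteq\omega_{2s}(I))$ and $\Phi_{\omega_s(I)}\circ\Psi_I=D(I\subseteq\omega_{2s}(I))$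 for all $I$. The interleaving distance $d_{\mathrm I}((Y,f),(Z,h))\in[0,\infty]$ is the infimum of all $s\ge 0$ for which $\mathcal{D}(Y,f)$ and $\mathcal{D}(Z,h)$ are $s$-interleaved. Statement. Let $X\subseteq\mathbb{R}^d$ be a closed set with positive reach and let $0<\beta<\tau(X)$. Let $A\subseteq\mathbb{R}^d$ and $0\le\varepsilon,\delta<\beta$ be such that $A\subseteq X^\delta$, $X\subseteq A^\varepsilon$ and $\varepsilon+\sqrt2\,\delta\le(\sqrt2-1)\beta$. Let $$\tfrac12\Bigl(\beta+\varepsilon-\sqrt{2(\beta-\delta)^2-(\beta+\varepsilon)^2}\Bigr)\ \le\ r\ \le\ \tfrac12\Bigl(\beta+\varepsilon+\sqrt{2(\beta-\delta)^2-(\beta+\varepsilon)^2}\Bigr),$$ let $k\ge 0$ and let $g:A^r\to\mathbb{R}$ be $k$-Lipschitz. Then $X\subseteq A^r$ and $$d_{\mathrm I}\bigl(\operatorname{Rb}(A^r,g),\operatorname{Rb}(X,g|_X)\bigr)\ \le\ k(r+\delta).$$ -/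

import Mathlib

open CategoryTheory
open scoped NNReal ENNReal

/-! ### Open intervals and their widenings -/

/-- A nonempty open interval `(lo, hi)` of `ℝ`; infinite endpoints are allowed. -/
structure OpenInterval where
  lo : EReal
  hi : EReal
  lo_lt_hi : lo < hi

namespace OpenInterval

/-- The underlying set of real numbers of an open interval. -/
def toSet (I : OpenInterval) : Set ℝ := {x : ℝ | I.lo < (x : EReal) ∧ (x : EReal) < I.hi}

/-- Open intervals are ordered by inclusion: the resulting (preorder) category has
the open intervals as objects and the inclusions as morphisms. -/
instance : Preorder OpenInterval where
  le I J := I.toSet ⊆ J.toSet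
  le_refl _ := subset_rfl
  le_trans _ _ _ h₁ h₂ := h₁.trans h₂

/-- The `δ`-thickening `(a - δ, b + δ)` of the open interval `(a, b)`. -/
noncomputable def widen (δ : ℝ≥0) (I : OpenInterval) : OpenInterval where
  lo := I.lo - ((δ : ℝ) : EReal)
  hi := I.hi + ((δ : ℝ) : EReal)
  lo_lt_hi := by
    have h1 : I.lo - ((δ : ℝ) : EReal) ≤ I.lo := by
      rw [sub_eq_add_neg]
      nth_rewrite 2 [← add_zero I.lo]
      gcongr
      rw [← EReal.coe_neg]
      exact_mod_cast neg_nonpos.2 δ.2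
    have h2 : I.hi ≤ I.hi + ((δ : ℝ) : EReal) := by
      nth_rewrite 1 [← add_zero I.hi]
      gcongr
      exact_mod_cast δ.2
    exact h1.trans_lt (I.lo_lt_hi.trans_le h2)

/-- The widening is the union of the closed `δ`-balls around the points of the interval. -/
theorem mem_toSet_widen {δ : ℝ≥0} {I : OpenInterval} {x : ℝ} :
    x ∈ (I.widen δ).toSet ↔ ∃ y ∈ I.toSet, |x - y| ≤ δ := by
  have hlo : (I.widen δ).lo < x ↔ I.lo < ((x + δ : ℝ) : EReal) := by
    rw [EReal.coe_add]
    exact EReal.sub_lt_iff (Or.inl (EReal.coe_ne_bot _)) (Or.inl (EReal.coe_ne_top _))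
  have hhi : (x : EReal) < (I.widen δ).hi ↔ ((x - δ : ℝ) : EReal) < I.hi := by
    rw [EReal.coe_sub]
    exact (EReal.sub_lt_iff (Or.inl (EReal.coe_ne_bot _)) (Or.inl (EReal.coe_ne_top _))).symm
  constructor
  · rintro ⟨h1, h2⟩
    rw [hlo] at h1
    rw [hhi] at h2
    rcases eq_or_lt_of_le (NNReal.coe_nonneg δ) with h0 | h0
    · rw [← h0, add_zero] at h1
      rw [← h0, sub_zero] at h2
      exact ⟨x, ⟨h1, h2⟩, by simp⟩
    · have h3 : ((x - δ : ℝ) : EReal) < ((x + δ : ℝ) : EReal) := by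
        exact_mod_cast (by linarith : x - (δ : ℝ) < x + δ)
      obtain ⟨y, hy1, hy2⟩ := EReal.lt_iff_exists_real_btwn.1
        (max_lt (lt_min I.lo_lt_hi h1) (lt_min h2 h3))
      rw [max_lt_iff] at hy1
      rw [lt_min_iff] at hy2
      refine ⟨y, ⟨hy1.1, hy2.1⟩, abs_le.2 ⟨?_, ?_⟩⟩
      · linarith [EReal.coe_lt_coe_iff.1 hy2.2]
      · linarith [EReal.coe_lt_coe_iff.1 hy1.2]
  · rintro ⟨y, ⟨h1, h2⟩, hxy⟩
    obtain ⟨h3, h4⟩ := abs_le.1 hxy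
    exact ⟨hlo.2 (h1.trans_le (EReal.coe_le_coe_iff.2 (by linarith))),
      hhi.2 (lt_of_le_of_lt (EReal.coe_le_coe_iff.2 (by linarith)) h2)⟩

theorem le_widen (δ : ℝ≥0) (I : OpenInterval) : I ≤ I.widen δ := fun x hx =>
  mem_toSet_widen.2 ⟨x, hx, by simp⟩

theorem widen_mono (δ : ℝ≥0) : Monotone (widen δ) := fun _ _ h _ hx => by
  obtain ⟨y, hy, hxy⟩ := mem_toSet_widen.1 hx
  exact mem_toSet_widen.2 ⟨y, h hy, hxy⟩

/-- Widening twice by `δ` is widening by `2δ`. -/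
theorem widen_widen (δ : ℝ≥0) (I : OpenInterval) : (I.widen δ).widen δ = I.widen (2 * δ) := by
  have h : (((2 * δ : ℝ≥0) : ℝ) : EReal) = ((δ : ℝ) : EReal) + ((δ : ℝ) : EReal) := by
    rw [NNReal.coe_mul, NNReal.coe_ofNat, two_mul, EReal.coe_add]
  unfold widen
  congr 1
  · simp only [h, sub_eq_add_neg]
    rw [EReal.neg_add (Or.inl (EReal.coe_ne_bot _)) (Or.inl (EReal.coe_ne_top _)),
      sub_eq_add_neg, add_assoc]
  · simp only [h, add_assoc]

/-- The widening functor `ω_δ`. -/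
noncomputable def widening (δ : ℝ≥0) : OpenInterval ⥤ OpenInterval := (widen_mono δ).functor

end OpenInterval

/-! ### Interleavings -/

universe v u

/-- A `δ`-interleaving `(Φ, Ψ)` between `C` and `D`. The target `ω_δ (ω_δ I)` of the two
composites is the interval `ω_{2δ} I` (see `OpenInterval.widen_widen`). -/
structure Interleaving {𝒜 : Type u} [Category.{v} 𝒜] (C D : OpenInterval ⥤ 𝒜) (δ : ℝ≥0) where
  Φ : C ⟶ OpenInterval.widening δ ⋙ D
  Ψ : D ⟶ OpenInterval.widening δ ⋙ C
  comp_left : ∀ I : OpenInterval, Φ.app I ≫ Ψ.app (I.widen δ) =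
    C.map (homOfLE ((I.le_widen δ).trans ((I.widen δ).le_widen δ)))
  comp_right : ∀ I : OpenInterval, Ψ.app I ≫ Φ.app (I.widen δ) =
    D.map (homOfLE ((I.le_widen δ).trans ((I.widen δ).le_widen δ)))

/-- The interleaving distance `inf {δ ≥ 0 | C and D are δ-interleaved} ∈ [0, ∞]`. -/
noncomputable def interleavingDist {𝒜 : Type u} [Category.{v} 𝒜]
    (C D : OpenInterval ⥤ 𝒜) : ℝ≥0∞ :=
  ⨅ (δ : ℝ≥0) (_ : Nonempty (Interleaving C D δ)), (δ : ℝ≥0∞)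

/-! ### Reeb precosheaf and Reeb graph of an `ℝ`-space

An `ℝ`-space is a topological space `X` with a continuous function `f : C(X, ℝ)`. -/

/-- The functor sending a topological space to its set of connected components. -/
def componentsFunctor : TopCat.{u} ⥤ Type u where
  obj X := ConnectedComponents X
  map φ := ↾(φ.hom.continuous.connectedComponentsMap)
  map_id X := by
    ext x
    obtain ⟨x, rfl⟩ := ConnectedComponents.surjective_coe x
    rfl
  map_comp φ ψ := by
    ext x
    obtain ⟨x, rfl⟩ := ConnectedComponents.surjective_coe x
    rfl

section RSpace

variable {X : Type u} [TopologicalSpace X] (f : C(X, ℝ))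

/-- The preimage functor `I ↦ f⁻¹(I)`, sending inclusions to inclusions. -/
def preimageFunctor : OpenInterval ⥤ TopCat.{u} where
  obj I := TopCat.of (f ⁻¹' I.toSet)
  map h := TopCat.ofHom ⟨Set.inclusion (Set.preimage_mono (leOfHom h)), continuous_inclusion _⟩

/-- The Reeb precosheaf: `I` is sent to the set of connected components of `f⁻¹(I)`. -/
def reebPrecosheaf : OpenInterval ⥤ Type u := preimageFunctor f ⋙ componentsFunctor

/-- Two points are equivalent if they lie in the same connected component of the same
level set of `f`. -/
def reebSetoid : Setoid X where
  r x y := y ∈ connectedComponentIn (f ⁻¹' {f x}) x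
  iseqv := by
    have key : ∀ {x y : X}, y ∈ connectedComponentIn (f ⁻¹' {f x}) x →
        f y = f x ∧
          connectedComponentIn (f ⁻¹' {f x}) x = connectedComponentIn (f ⁻¹' {f y}) y := by
      intro x y h
      have hy : f y = f x := by
        simpa using connectedComponentIn_subset _ _ h
      refine ⟨hy, ?_⟩
      rw [hy]
      exact connectedComponentIn_eq h
    refine ⟨fun x => mem_connectedComponentIn rfl, fun {x y} h => ?_, fun {x y z} h h' => ?_⟩
    · rw [← (key h).2]
      exact mem_connectedComponentIn rfl
    · rw [(key h).2]
      exact h'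

/-- The Reeb graph, with the quotient topology. -/
def ReebGraph : Type u := Quotient (reebSetoid f)

instance : TopologicalSpace (ReebGraph f) :=
  inferInstanceAs (TopologicalSpace (Quotient (reebSetoid f)))

/-- The continuous map on the Reeb graph induced by `f`, `[x] ↦ f x`. -/
def reebMap : C(ReebGraph f, ℝ) where
  toFun := Quotient.lift f fun x y (h : y ∈ connectedComponentIn (f ⁻¹' {f x}) x) =>
    (show f y = f x by simpa using connectedComponentIn_subset _ _ h).symm
  continuous_toFun := f.continuous.quotient_lift _

end RSpace

/-- The interleaving distance of the `ℝ`-spaces `(X, f)` and `(Y, g)`, that is, of their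
Reeb precosheaves. -/
noncomputable def rSpaceDist {X Y : Type u} [TopologicalSpace X] [TopologicalSpace Y]
    (f : C(X, ℝ)) (g : C(Y, ℝ)) : ℝ≥0∞ :=
  interleavingDist (reebPrecosheaf f) (reebPrecosheaf g)

/-! ### Thickenings and reach -/

section Metric

variable {M : Type*} [MetricSpace M]

/-- The `r`-thickening: the union of the closed balls of radius `r` centred in `X`. -/
def closedThickening (r : ℝ) (X : Set M) : Set M := {p | ∃ x ∈ X, dist x p ≤ r}

/-- The points with a unique nearest point in `X`. -/
def uniqueNearest (X : Set M) : Set M :=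
  {p | ∃ x ∈ X, ∀ x' ∈ X \ {x}, dist x p < dist x' p}

/-- The reach `sup {r ≥ 0 | X^r ⊆ Unp X} ∈ [0, ∞]`. -/
noncomputable def reach (X : Set M) : ℝ≥0∞ :=
  ⨆ (r : ℝ≥0) (_ : closedThickening r X ⊆ uniqueNearest X), (r : ℝ≥0∞)

end Metric

/-! The nearest point projection `A^r → X` and the inclusion `X → A^r` induce the interleaving. One
composite is the identity of `X`. The other moves `p` along the segment to its nearest point `x`,
whose length is at most `r + δ`; if the segment stays in `A^r`, then `g` varies along it by at most
`k(r + δ)`, and it joins the two points inside the widened preimage (`reebInterleaving`). Passing to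
Reeb graphs changes nothing, since the quotient map induces an isomorphism of precosheaves
(`reebPrecosheafIso`).

The geometric core is `segment_nearestPoint_subset`. Positive reach yields a ball of radius `β`
tangent to `X` at `x`, on the side of `p`, with no point of `X` in its interior
(`exists_tangent_ball`); the concentric open ball of radius `β - δ` then misses `A`. Near `x` the
segment is covered by a sample point `ε`-close to `x`; farther out, the sample point covering `p`
must cover it too, or it would enter the smaller ball (`dist_add_smul_le_or`). -/

theorem OpenInterval.isOpen_toSet (I : OpenInterval) : IsOpen I.toSet :=
  (isOpen_lt continuous_const continuous_coe_real_ereal).inter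
    (isOpen_lt continuous_coe_real_ereal continuous_const)

/-! ### Interleavings of Reeb precosheaves from continuous maps -/

section Precosheaf

variable {X Y : Type u} [TopologicalSpace X] [TopologicalSpace Y]

/-- A continuous map that moves the values of the functions by at most `s` sends the preimage of
`I` to the preimage of the `s`-widening of `I`. -/
noncomputable def preimageHom (f : C(X, ℝ)) (g : C(Y, ℝ)) (s : ℝ≥0) (φ : C(X, Y))
    (h : ∀ x, |g (φ x) - f x| ≤ s) :
    preimageFunctor f ⟶ OpenInterval.widening s ⋙ preimageFunctor g where
  app I := TopCat.ofHom
    ⟨fun x : f ⁻¹' I.toSet => (⟨φ x.1, OpenInterval.mem_toSet_widen.2 ⟨f x.1, x.2, h x.1⟩⟩ :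
      g ⁻¹' (I.widen s).toSet), by fun_prop⟩

/-- The morphism of Reeb precosheaves induced by a continuous map that moves the values of the
functions by at most `s`. -/
noncomputable def reebPrecosheafHom (f : C(X, ℝ)) (g : C(Y, ℝ)) (s : ℝ≥0) (φ : C(X, Y))
    (h : ∀ x, |g (φ x) - f x| ≤ s) :
    reebPrecosheaf f ⟶ OpenInterval.widening s ⋙ reebPrecosheaf g :=
  Functor.whiskerRight (preimageHom f g s φ h) componentsFunctor

/-- The set `S` lies in the preimage of the widened interval, so `x` and `ψ (φ x)` share a component
there. -/
theorem reebPrecosheafHom_comp (f : C(X, ℝ)) (g : C(Y, ℝ)) (s : ℝ≥0) (φ : C(X, Y)) (ψ : C(Y, X))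
    (hφ : ∀ x, |g (φ x) - f x| ≤ s) (hψ : ∀ y, |f (ψ y) - g y| ≤ s)
    (H : ∀ x, ∃ S : Set X, IsPreconnected S ∧ x ∈ S ∧ ψ (φ x) ∈ S ∧ ∀ z ∈ S, |f z - f x| ≤ s)
    (I : OpenInterval) :
    (reebPrecosheafHom f g s φ hφ).app I ≫ (reebPrecosheafHom g f s ψ hψ).app (I.widen s) =
      (reebPrecosheaf f).map (homOfLE ((I.le_widen s).trans ((I.widen s).le_widen s))) := by
  ext x
  obtain ⟨x, rfl⟩ := ConnectedComponents.surjective_coe x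
  obtain ⟨S, hS, hxS, hyS, hSf⟩ := H x.1
  have hsub : S ⊆ f ⁻¹' ((I.widen s).widen s).toSet := fun z hz =>
    OpenInterval.le_widen s _ (OpenInterval.mem_toSet_widen.2 ⟨f x.1, x.2, hSf z hz⟩)
  have hT : IsPreconnected ((↑) ⁻¹' S : Set (f ⁻¹' ((I.widen s).widen s).toSet)) := by
    rw [← Topology.IsInducing.subtypeVal.isPreconnected_image, Subtype.image_preimage_coe,
      Set.inter_eq_right.2 hsub]
    exact hS
  refine ConnectedComponents.coe_eq_coe'.2 ?_
  have hle := hT.subset_connectedComponent (x := ⟨x.1, hsub hxS⟩) hxS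
  exact hle (show (⟨ψ (φ x.1), hsub hyS⟩ : f ⁻¹' ((I.widen s).widen s).toSet) ∈ _ from hyS)

/-- Maps in both directions that move the values of the functions by at most `s`, and whose
composites move each point inside a connected set on which the function varies by at most `s`,
induce an `s`-interleaving of the Reeb precosheaves. -/
noncomputable def reebInterleaving (f : C(X, ℝ)) (g : C(Y, ℝ)) (s : ℝ≥0) (φ : C(X, Y)) (ψ : C(Y, X))
    (hφ : ∀ x, |g (φ x) - f x| ≤ s) (hψ : ∀ y, |f (ψ y) - g y| ≤ s)
    (Hf : ∀ x, ∃ S : Set X, IsPreconnected S ∧ x ∈ S ∧ ψ (φ x) ∈ S ∧ ∀ z ∈ S, |f z - f x| ≤ s)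
    (Hg : ∀ y, ∃ S : Set Y, IsPreconnected S ∧ y ∈ S ∧ φ (ψ y) ∈ S ∧ ∀ z ∈ S, |g z - g y| ≤ s) :
    Interleaving (reebPrecosheaf f) (reebPrecosheaf g) s where
  Φ := reebPrecosheafHom f g s φ hφ
  Ψ := reebPrecosheafHom g f s ψ hψ
  comp_left := reebPrecosheafHom_comp f g s φ ψ hφ hψ Hf
  comp_right := reebPrecosheafHom_comp g f s ψ φ hψ hφ Hg

theorem comp_comp_cancel {𝒜 : Type u} [Category.{v} 𝒜] {A B C C' D E : 𝒜} (a : A ⟶ B)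
    {b : B ⟶ C} {c : C ⟶ C'} {c' : C' ⟶ C} {d : C ⟶ D} {m : B ⟶ D} (hc : c ≫ c' = 𝟙 C)
    (hm : b ≫ d = m) (e : D ⟶ E) : (a ≫ b ≫ c) ≫ c' ≫ d ≫ e = a ≫ m ≫ e := by
  subst hm
  simp [reassoc_of% hc]

theorem inv_app_comp_map_comp_hom_app {ℬ : Type*} {𝒜 : Type*} [Category* ℬ] [Category* 𝒜]
    {C D : ℬ ⥤ 𝒜} (e : C ≅ D) {I J : ℬ} (h : I ⟶ J) :
    e.inv.app I ≫ C.map h ≫ e.hom.app J = D.map h := by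
  simp

/-- Interleavings are transported along isomorphisms. -/
noncomputable def Interleaving.ofIso {𝒜 : Type u} [Category.{v} 𝒜] {C C' D D' : OpenInterval ⥤ 𝒜} {s : ℝ≥0}
    (i : Interleaving C D s) (e : C ≅ C') (e' : D ≅ D') : Interleaving C' D' s where
  Φ := e.inv ≫ i.Φ ≫ Functor.whiskerLeft _ e'.hom
  Ψ := e'.inv ≫ i.Ψ ≫ Functor.whiskerLeft _ e.hom
  comp_left I := by
    refine (comp_comp_cancel _ (Iso.hom_inv_id_app e' (I.widen s)) (i.comp_left I) _).trans ?_
    exact inv_app_comp_map_comp_hom_app e _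
  comp_right I := by
    refine (comp_comp_cancel _ (Iso.hom_inv_id_app e (I.widen s)) (i.comp_right I) _).trans ?_
    exact inv_app_comp_map_comp_hom_app e' _

end Precosheaf

/-! ### Invariance of the precosheaf under passage to the Reeb graph -/

section ReebGraph

/-- Components are closed, and a quotient map with connected fibres pulls closed connected sets back
to connected sets; this gives injectivity. -/
theorem Topology.IsQuotientMap.bijective_connectedComponentsMap {X Y : Type*} [TopologicalSpace X]
    [TopologicalSpace Y] {q : X → Y} (hq : Topology.IsQuotientMap q)
    (hfib : ∀ y, IsConnected (q ⁻¹' {y})) :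
    Function.Bijective hq.continuous.connectedComponentsMap := by
  constructor
  · intro a b hab
    obtain ⟨a, rfl⟩ := ConnectedComponents.surjective_coe a
    obtain ⟨b, rfl⟩ := ConnectedComponents.surjective_coe b
    have h : q a ∈ connectedComponent (q b) := ConnectedComponents.coe_eq_coe'.1 hab
    refine ConnectedComponents.coe_eq_coe'.2 ?_
    have h' := hq.isCoinducing.isConnected_preimage_of_isClosed hfib
      (isClosed_connectedComponent (x := q b)) isConnected_connectedComponent
    exact h'.isPreconnected.subset_connectedComponent (mem_connectedComponent (x := q b)) h
  · intro b
    obtain ⟨b, rfl⟩ := ConnectedComponents.surjective_coe b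
    obtain ⟨a, rfl⟩ := hq.surjective b
    exact ⟨a, rfl⟩

variable {X : Type u} [TopologicalSpace X] (f : C(X, ℝ))

/-- The quotient map from a space to its Reeb graph. -/
def reebMk : C(X, ReebGraph f) := ⟨Quotient.mk (reebSetoid f), continuous_quotient_mk'⟩

theorem isQuotientMap_reebMk : Topology.IsQuotientMap (reebMk f) := isQuotientMap_quotient_mk'

theorem reebMk_preimage_singleton (x : X) :
    reebMk f ⁻¹' {reebMk f x} = connectedComponentIn (f ⁻¹' {f x}) x := by
  ext y
  exact ⟨fun h => Quotient.exact (Eq.symm h), fun h => (Quotient.sound h).symm⟩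

/-- The restriction of the quotient map to the Reeb graph to preimages of intervals. -/
def preimageReebMk : preimageFunctor f ⟶ preimageFunctor (reebMap f) where
  app I := TopCat.ofHom ⟨(reebMap f ⁻¹' I.toSet).restrictPreimage (reebMk f),
    (reebMk f).continuous.restrictPreimage⟩

/-- The morphism of Reeb precosheaves induced by the quotient map to the Reeb graph. -/
def reebPrecosheafReebMk : reebPrecosheaf f ⟶ reebPrecosheaf (reebMap f) :=
  Functor.whiskerRight (preimageReebMk f) componentsFunctor

theorem bijective_reebPrecosheafReebMk_app (I : OpenInterval) :
    Function.Bijective ((reebPrecosheafReebMk f).app I) := by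
  -- A restricted quotient map need not be a quotient map; openness of the interval ensures it here.
  have hq := (isQuotientMap_reebMk f).restrictPreimage_isOpen
    (I.isOpen_toSet.preimage (reebMap f).continuous)
  refine hq.bijective_connectedComponentsMap fun y => ?_
  obtain ⟨⟨x, hx⟩, rfl⟩ := hq.surjective y
  refine ⟨⟨_, rfl⟩, ?_⟩
  rw [← Topology.IsInducing.subtypeVal.isPreconnected_image]
  convert isPreconnected_connectedComponentIn (F := f ⁻¹' {f x}) (x := x) using 1
  rw [← reebMk_preimage_singleton]
  ext z
  constructor
  · rintro ⟨z, hz, rfl⟩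
    exact congrArg Subtype.val hz
  · intro hz
    have hz' : reebMk f z = reebMk f x := hz
    refine ⟨⟨z, ?_⟩, Subtype.ext hz, rfl⟩
    change reebMap f (reebMk f z) ∈ I.toSet
    rw [hz']
    exact hx

/-- A space and its Reeb graph have isomorphic Reeb precosheaves. -/
noncomputable def reebPrecosheafIso : reebPrecosheaf f ≅ reebPrecosheaf (reebMap f) :=
  haveI (I : OpenInterval) : IsIso ((reebPrecosheafReebMk f).app I) :=
    (isIso_iff_bijective _).2 (bijective_reebPrecosheafReebMk_app f I)
  NatIso.ofComponents (fun I => asIso ((reebPrecosheafReebMk f).app I))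
    fun h => (reebPrecosheafReebMk f).naturality h

theorem rSpaceDist_reebMap_le {Y : Type u} [TopologicalSpace Y] {f : C(X, ℝ)} {g : C(Y, ℝ)}
    {s : ℝ≥0} (i : Interleaving (reebPrecosheaf f) (reebPrecosheaf g) s) :
    rSpaceDist (reebMap f) (reebMap g) ≤ s :=
  iInf₂_le s ⟨i.ofIso (reebPrecosheafIso f) (reebPrecosheafIso g)⟩

end ReebGraph

/-! ### Nearest point projection and tangent balls -/

section NearestPoint

open scoped Topology

section Proper

variable {M : Type*} [MetricSpace M]

open Classical in
/-- A nearest point of `p` in `X`, or `p` itself if there is none. -/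
noncomputable def nearestPoint (X : Set M) (p : M) : M :=
  if h : ∃ x ∈ X, Metric.infDist p X = dist p x then h.choose else p

theorem eq_of_mem_uniqueNearest {X : Set M} {p x y : M} (hp : p ∈ uniqueNearest X) (hx : x ∈ X)
    (hy : y ∈ X) (hxp : dist p x ≤ Metric.infDist p X) (hyp : dist p y ≤ Metric.infDist p X) :
    x = y := by
  obtain ⟨z, hz, hmin⟩ := hp
  have key : ∀ w ∈ X, dist p w ≤ Metric.infDist p X → w = z := fun w hw hwp => by
    by_contra hne
    have h1 := hmin w ⟨hw, hne⟩
    have h2 := Metric.infDist_le_dist_of_mem (x := p) hz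
    rw [dist_comm z, dist_comm w] at h1
    linarith
  rw [key x hx hxp, key y hy hyp]

variable [ProperSpace M] {X : Set M}

theorem nearestPoint_spec (hX : IsClosed X) (hne : X.Nonempty) (p : M) :
    nearestPoint X p ∈ X ∧ Metric.infDist p X = dist p (nearestPoint X p) := by
  have h : ∃ x ∈ X, Metric.infDist p X = dist p x := hX.exists_infDist_eq_dist hne p
  rw [nearestPoint, dif_pos h]
  exact h.choose_spec

theorem nearestPoint_of_mem (hX : IsClosed X) {p : M} (hp : p ∈ X) : nearestPoint X p = p := by
  have h := (nearestPoint_spec hX ⟨p, hp⟩ p).2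
  rw [Metric.infDist_zero_of_mem hp] at h
  exact (dist_eq_zero.1 h.symm).symm

/-- The nearest point projection is continuous at points with a unique nearest point. -/
theorem continuousAt_nearestPoint (hX : IsClosed X) (hne : X.Nonempty) {p : M}
    (hp : p ∈ uniqueNearest X) : ContinuousAt (nearestPoint X) p := by
  rw [Metric.continuousAt_iff]
  intro e he
  obtain ⟨hpm, hpd⟩ := nearestPoint_spec hX hne p
  rcases (X \ Metric.ball (nearestPoint X p) e).eq_empty_or_nonempty with hK | hK
  · exact ⟨1, one_pos, fun {q} _ =>
      Set.sdiff_eq_empty.1 hK (nearestPoint_spec hX hne q).1⟩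
  · obtain ⟨z, hz, hzd⟩ := (hX.sdiff Metric.isOpen_ball).exists_infDist_eq_dist hK p
    have hlt : Metric.infDist p X < dist p z := by
      by_contra! hle
      refine hz.2 ?_
      rw [eq_of_mem_uniqueNearest hp hz.1 hpm hle hpd.ge]
      exact Metric.mem_ball_self he
    -- Half the gap suffices: moving from `p` to `q` changes the distances to `X` and to its part
    -- outside the ball by at most `dist p q` each.
    refine ⟨(dist p z - Metric.infDist p X) / 2, by linarith, fun {q} hq => ?_⟩
    obtain ⟨hqm, hqd⟩ := nearestPoint_spec hX hne q
    by_contra hfar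
    have h1 := Metric.infDist_le_dist_of_mem (x := p)
      (show nearestPoint X q ∈ X \ Metric.ball (nearestPoint X p) e from ⟨hqm, hfar⟩)
    have h2 := dist_triangle p q (nearestPoint X q)
    have h3 := Metric.infDist_le_infDist_add_dist (s := X) (x := q) (y := p)
    rw [dist_comm p q] at h2
    linarith

end Proper

section InnerProduct

variable {E : Type*} [NormedAddCommGroup E] [InnerProductSpace ℝ E] [ProperSpace E] {X : Set E}

/-- Away from `X`, the distance to `X` increases at rate arbitrarily close to `1` in the direction
pointing away from the nearest point. -/
theorem exists_infDist_add_mul_le (hX : IsClosed X) (hne : X.Nonempty) {q : E}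
    (hq : q ∈ uniqueNearest X) (hd : 0 < Metric.infDist q X) {c η : ℝ} (hc : 0 ≤ c) (hc1 : c < 1)
    (hη : 0 < η) :
    ∃ q' : E, ∃ h : ℝ, 0 < h ∧ h < η ∧ dist q' q = h ∧
      Metric.infDist q X + c * h ≤ Metric.infDist q' X := by
  obtain ⟨hqm, hqd⟩ := nearestPoint_spec hX hne q
  set x := nearestPoint X q with hx
  set D := Metric.infDist q X with hD
  set n : E := D⁻¹ • (q - x) with hn
  have hnorm : ‖q - x‖ = D := by rw [hqd, dist_eq_norm]
  have hn1 : ‖n‖ = 1 := by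
    rw [hn, norm_smul, hnorm, norm_inv, Real.norm_of_nonneg hd.le, inv_mul_cancel₀ hd.ne']
  have hinner : inner ℝ n (q - x) = D := by
    rw [hn, real_inner_smul_left, real_inner_self_eq_norm_sq, hnorm]
    field_simp
  -- Continuity of the projection keeps this inner product above `c * D` for small `h`; expanding
  -- the square then gives at least `D² + 2hcD + h² ≥ (D + ch)²`.
  have hcont : ContinuousAt (fun h : ℝ => inner ℝ n (q - nearestPoint X (q + h • n))) 0 := by
    have h1 : ContinuousAt (nearestPoint X) (q + (0 : ℝ) • n) := by
      simpa using continuousAt_nearestPoint hX hne hq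
    have h2 : ContinuousAt (fun h : ℝ => nearestPoint X (q + h • n)) 0 :=
      ContinuousAt.comp (f := fun h : ℝ => q + h • n) h1 (by fun_prop)
    exact ContinuousAt.inner continuousAt_const (continuousAt_const.sub h2)
  have hev : ∀ᶠ h : ℝ in 𝓝 0, c * D < inner ℝ n (q - nearestPoint X (q + h • n)) := by
    refine hcont.eventually_const_lt ?_
    beta_reduce
    rw [zero_smul, add_zero, ← hx, hinner]
    nlinarith
  obtain ⟨e, he, hball⟩ := Metric.eventually_nhds_iff.1 hev
  have hmin : 0 < min e η := lt_min he hη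
  refine ⟨q + (min e η / 2) • n, min e η / 2, by linarith, by linarith [min_le_right e η], ?_, ?_⟩
  · rw [dist_eq_norm, add_sub_cancel_left, norm_smul, hn1, mul_one,
      Real.norm_of_nonneg (by linarith)]
  · have hh : 0 < min e η / 2 := by linarith
    have hlt := @hball (min e η / 2) (by
      rw [Real.dist_eq, sub_zero, abs_of_pos hh]
      linarith [min_le_left e η])
    set h := min e η / 2
    obtain ⟨hym, hyd⟩ := nearestPoint_spec hX hne (q + h • n)
    set y := nearestPoint X (q + h • n)
    have hle : D ≤ ‖q - y‖ := by
      rw [← dist_eq_norm]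
      exact Metric.infDist_le_dist_of_mem hym
    have hexp : ‖q + h • n - y‖ ^ 2 = ‖q - y‖ ^ 2 + 2 * h * inner ℝ n (q - y) + h ^ 2 := by
      rw [add_sub_right_comm, norm_add_sq_real, real_inner_smul_right, real_inner_comm, norm_smul,
        hn1, mul_one, Real.norm_eq_abs, sq_abs]
      ring
    rw [hyd, dist_eq_norm]
    refine abs_le_of_sq_le_sq' ?_ (norm_nonneg _) |>.2
    rw [hexp]
    have h1 : D ^ 2 ≤ ‖q - y‖ ^ 2 := by gcongr
    have h2 : h * (c * D) ≤ h * inner ℝ n (q - y) := by gcongr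
    have h3 : c ^ 2 * h ^ 2 ≤ 1 * h ^ 2 := by
      gcongr
      nlinarith
    nlinarith

/-- If all points at distance less than `β` from `X` have a unique nearest point, then from a
point `p` at distance at most `β` one reaches distance `β` within `β - infDist p X`. -/
theorem exists_le_infDist (hX : IsClosed X) (hne : X.Nonempty) {β : ℝ}
    (hβ : ∀ q, Metric.infDist q X < β → q ∈ uniqueNearest X) {p : E}
    (hp : 0 < Metric.infDist p X) (hpβ : Metric.infDist p X ≤ β) :
    ∃ q, dist q p ≤ β - Metric.infDist p X ∧ β ≤ Metric.infDist q X := by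
  rcases hpβ.eq_or_lt with h | hlt
  · exact ⟨p, by simp [h], h.ge⟩
  set t := Metric.infDist p X
  have hK : IsCompact (Metric.closedBall p (β - t)) := isCompact_closedBall _ _
  have hpK : p ∈ Metric.closedBall p (β - t) := Metric.mem_closedBall_self (by linarith)
  have hcd : Continuous fun q : E => Metric.infDist q X := Metric.continuous_infDist_pt X
  have rate : ∀ c : ℝ, 0 ≤ c → c < 1 →
      ∃ q ∈ Metric.closedBall p (β - t), t + c * (β - t) ≤ Metric.infDist q X := by
    intro c hc hc1
    -- A maximizer of this penalized distance must lie on the sphere: inside, a step gaining at rate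
    -- `(c + 1) / 2 > c` would increase it.
    obtain ⟨q, hq, hmax⟩ := hK.exists_isMaxOn ⟨p, hpK⟩
      (f := fun q => Metric.infDist q X - c * dist q p) (by fun_prop)
    have hqp : t + c * dist q p ≤ Metric.infDist q X := by
      have h : t - c * dist p p ≤ Metric.infDist q X - c * dist q p := hmax hpK
      rw [dist_self] at h
      linarith
    rcases (Metric.mem_closedBall.1 hq).eq_or_lt with heq | hlt'
    · exact ⟨q, hq, heq ▸ hqp⟩
    exfalso
    have hqβ : Metric.infDist q X < β := by
      have := Metric.infDist_le_infDist_add_dist (s := X) (x := q) (y := p)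
      linarith
    have hq0 : 0 < Metric.infDist q X := by
      have : 0 ≤ c * dist q p := by positivity
      linarith
    obtain ⟨q', h, hh, hhη, hd, hinc⟩ := exists_infDist_add_mul_le hX hne (hβ q hqβ) hq0
      (c := (c + 1) / 2) (η := β - t - dist q p) (by linarith) (by linarith) (by linarith)
    have htri := dist_triangle q' q p
    have hq'K : q' ∈ Metric.closedBall p (β - t) := by
      rw [Metric.mem_closedBall]
      linarith
    have h1 : Metric.infDist q' X - c * dist q' p ≤ Metric.infDist q X - c * dist q p :=
      hmax hq'K
    have h2 : c * dist q' p ≤ c * (h + dist q p) := by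
      gcongr
      linarith
    nlinarith
  obtain ⟨q, hq, hmax⟩ := hK.exists_isMaxOn ⟨p, hpK⟩ hcd.continuousOn
  refine ⟨q, hq, ?_⟩
  by_contra! hqβ
  have htq : t ≤ Metric.infDist q X := hmax hpK
  have hpos : 0 < β - t := by linarith
  have hval : (Metric.infDist q X - t) / (β - t) < 1 := (div_lt_one hpos).2 (by linarith)
  have hval0 : 0 ≤ (Metric.infDist q X - t) / (β - t) := div_nonneg (by linarith) hpos.le
  -- A rate halfway between the best attained one and `1` contradicts maximality.
  obtain ⟨q', hq', hle⟩ := rate (((Metric.infDist q X - t) / (β - t) + 1) / 2) (by linarith)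
    (by linarith)
  have hle' : Metric.infDist q' X ≤ Metric.infDist q X := hmax hq'
  have : ((Metric.infDist q X - t) / (β - t) + 1) / 2 * (β - t) =
      (Metric.infDist q X - t + (β - t)) / 2 := by
    field_simp
  linarith

/-- The ball of radius `β` tangent to `X` at the nearest point of `p`, on the side of `p`, contains
no point of `X` in its interior. -/
theorem exists_tangent_ball (hX : IsClosed X) (hne : X.Nonempty) {β : ℝ}
    (hβ : ∀ q, Metric.infDist q X < β → q ∈ uniqueNearest X) {p : E}
    (hp : 0 < Metric.infDist p X) (hpβ : Metric.infDist p X ≤ β) :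
    ∃ n : E, ‖n‖ = 1 ∧ p = nearestPoint X p + Metric.infDist p X • n ∧
      ∀ y ∈ X, β ≤ dist y (nearestPoint X p + β • n) := by
  obtain ⟨q, hqp, hq⟩ := exists_le_infDist hX hne hβ hp hpβ
  obtain ⟨hxm, hxd⟩ := nearestPoint_spec hX hne p
  set x := nearestPoint X p
  set t := Metric.infDist p X
  have hβ0 : 0 < β := hp.trans_le hpβ
  have h1 : β ≤ dist q x := hq.trans (Metric.infDist_le_dist_of_mem hxm)
  have h2 := dist_triangle q p x
  have hqx : dist x q = β := by
    rw [dist_comm]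
    linarith
  have hqp' : dist p q = β - t := by
    rw [dist_comm]
    linarith
  -- The triangle inequality for `x`, `p`, `q` is an equality, so strict convexity puts `p` on the
  -- segment.
  have hline : p = AffineMap.lineMap x q (t / β) := by
    refine eq_lineMap_of_dist_eq_mul_of_dist_eq_mul ?_ ?_
    · rw [hqx, dist_comm, ← hxd]
      field_simp
    · rw [hqx, hqp']
      field_simp
  have hq' : x + β • β⁻¹ • (q - x) = q := by
    rw [smul_inv_smul₀ hβ0.ne', add_sub_cancel]
  refine ⟨β⁻¹ • (q - x), ?_, ?_, fun y hy => ?_⟩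
  · rw [norm_smul, ← dist_eq_norm, dist_comm, hqx, norm_inv, Real.norm_of_nonneg hβ0.le,
      inv_mul_cancel₀ hβ0.ne']
  · conv_lhs => rw [hline]
    rw [AffineMap.lineMap_apply_module', smul_smul, div_eq_mul_inv, add_comm]
  · rw [hq', dist_comm]
    exact hq.trans (Metric.infDist_le_dist_of_mem hy)

end InnerProduct

end NearestPoint

/-! ### Covering the projection segments by balls around the sample -/

section Covering

theorem dist_add_smul_sq {E : Type*} [NormedAddCommGroup E] [InnerProductSpace ℝ E] {n : E}
    (hn : ‖n‖ = 1) (x a : E) (s : ℝ) :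
    dist (x + s • n) a ^ 2 = s ^ 2 - 2 * s * inner ℝ n (a - x) + ‖a - x‖ ^ 2 := by
  rw [dist_eq_norm, show x + s • n - a = s • n - (a - x) by abel, norm_sub_sq_real, norm_smul, hn,
    real_inner_smul_left, mul_one, Real.norm_eq_abs, sq_abs]
  ring

/-- If the ball of radius `ρ` around `x + β • n` does not contain `a` in its interior, then each
point between `x` and a point `x + t • n` at distance at most `r` from `a` is at distance at most
`r` from `a` or from `b`, where `b` is a point at distance at most `ε` from `x`. -/
theorem dist_add_smul_le_or {E : Type*} [NormedAddCommGroup E] [InnerProductSpace ℝ E]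
    {n x a b : E} {β ρ ε r s t : ℝ} (hn : ‖n‖ = 1) (hr : 0 ≤ r) (hρ : 0 ≤ ρ) (hs : 0 ≤ s)
    (hst : s ≤ t) (htβ : t ≤ β) (hat : dist a (x + t • n) ≤ r) (haβ : ρ ≤ dist a (x + β • n))
    (hb : dist b x ≤ ε) (hρr : r ^ 2 + (β + ε - r) ^ 2 ≤ ρ ^ 2) :
    dist a (x + s • n) ≤ r ∨ dist b (x + s • n) ≤ r := by
  rcases le_or_gt s (r - ε) with hsr | hsr
  · right
    have h1 := dist_triangle b x (x + s • n)
    have h2 : dist x (x + s • n) = s := by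
      rw [dist_self_add_right, norm_smul, hn, mul_one, Real.norm_of_nonneg hs]
    linarith
  · left
    by_contra! hlt
    have e1 : dist a (x + s • n) ^ 2 > r ^ 2 := by gcongr
    have e2 : dist a (x + t • n) ^ 2 ≤ r ^ 2 := by gcongr
    have e3 : ρ ^ 2 ≤ dist a (x + β • n) ^ 2 := by gcongr
    rw [dist_comm, dist_add_smul_sq hn] at e1 e2 e3
    -- From `e1` and `e2`, `t + s < 2i`. From `e2` and `e3`, `ρ² - r² ≤ (β - t)(β + t - 2i)`. As `s
    -- > r - ε`, together these force `(β - s)² ≤ (β - t)(β - s)`, impossible for `s < t ≤ β`.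
    set i := inner ℝ n (a - x)
    have hst' : 0 < t - s := by
      rcases hst.eq_or_lt with h | h
      · subst h
        linarith
      · linarith
    have h1 : 0 < 2 * i - (t + s) := by
      have : 0 < (t - s) * (2 * i - (t + s)) := by nlinarith
      exact (mul_pos_iff_of_pos_left hst').1 this
    have h2 : (β - s) ^ 2 ≤ (β + ε - r) ^ 2 :=
      pow_le_pow_left₀ (by linarith) (by linarith) 2
    have h3 : (β - s) ^ 2 ≤ (β - t) * (β + t - 2 * i) := by nlinarith
    have h4 : (β - t) * (β + t - 2 * i) ≤ (β - t) * (β - s) :=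
      mul_le_mul_of_nonneg_left (by linarith) (by linarith)
    nlinarith

theorem closedThickening_mono {M : Type*} [MetricSpace M] (A : Set M) :
    Monotone fun r => closedThickening r A :=
  fun _ _ h _ ⟨a, ha, hap⟩ => ⟨a, ha, hap.trans h⟩

theorem infDist_le_of_mem_closedThickening {M : Type*} [MetricSpace M] {X A : Set M} {δ r : ℝ}
    (hAX : A ⊆ closedThickening δ X) {p : M} (hp : p ∈ closedThickening r A) : Metric.infDist p X ≤ r + δ := by
  obtain ⟨a, ha, hap⟩ := hp
  obtain ⟨y, hy, hya⟩ := hAX ha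
  have h1 := Metric.infDist_le_dist_of_mem (x := p) hy
  have h2 := dist_triangle_right p y a
  rw [dist_comm p a] at h2
  linarith

/-- Points at distance less than the reach have a unique nearest point. -/
theorem mem_uniqueNearest_of_infDist_le {M : Type*} [MetricSpace M] [ProperSpace M] {X : Set M}
    {β : ℝ} (hX : IsClosed X) (hne : X.Nonempty) (hβ : ENNReal.ofReal β < reach X) {q : M}
    (hq : Metric.infDist q X ≤ β) :
    q ∈ uniqueNearest X := by
  obtain ⟨s, hs⟩ := lt_iSup_iff.1 hβ
  obtain ⟨hsX, hs⟩ := lt_iSup_iff.1 hs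
  obtain ⟨hxm, hxd⟩ := nearestPoint_spec hX hne q
  refine hsX ⟨_, hxm, ?_⟩
  rw [dist_comm, ← hxd]
  exact hq.trans ((Real.toNNReal_le_iff_le_coe).1 (ENNReal.coe_lt_coe.1 hs).le)

variable {E : Type*} [NormedAddCommGroup E] [InnerProductSpace ℝ E] [ProperSpace E] {X A : Set E}
  {β ε δ r : ℝ}

/-- The segment from a point of a thickening of a sample `A` of `X` to its nearest point in `X`
stays in the thickening. -/
theorem segment_nearestPoint_subset (hX : IsClosed X)
    (hβ : ∀ q, Metric.infDist q X < β → q ∈ uniqueNearest X) (hε : 0 ≤ ε) (hδβ : δ ≤ β)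
    (hAX : A ⊆ closedThickening δ X) (hXA : X ⊆ closedThickening ε A) (hεr : ε ≤ r)
    (hrβ : r + δ ≤ β) (hr : r ^ 2 + (β + ε - r) ^ 2 ≤ (β - δ) ^ 2) {p : E}
    (hp : p ∈ closedThickening r A) :
    segment ℝ (nearestPoint X p) p ⊆ closedThickening r A := by
  obtain ⟨a, ha, hap⟩ := id hp
  obtain ⟨y, hy, hya⟩ := hAX ha
  have hne : X.Nonempty := ⟨y, hy⟩
  obtain ⟨hxm, hxd⟩ := nearestPoint_spec hX hne p
  rcases Metric.infDist_nonneg (x := p) (s := X).eq_or_lt with h0 | hpos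
  · rw [← dist_eq_zero.1 (hxd.symm.trans h0.symm), segment_same]
    rintro _ rfl
    exact ⟨a, ha, hap⟩
  have hpβ : Metric.infDist p X ≤ β :=
    (infDist_le_of_mem_closedThickening hAX hp).trans hrβ
  obtain ⟨n, hn, hpn, hball⟩ := exists_tangent_ball hX hne hβ hpos hpβ
  obtain ⟨b, hb, hbx⟩ := hXA hxm
  set x := nearestPoint X p
  set t := Metric.infDist p X
  rw [segment_eq_image']
  rintro _ ⟨θ, ⟨hθ0, hθ1⟩, rfl⟩
  have hq : x + θ • (p - x) = x + (θ * t) • n := by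
    rw [hpn, add_sub_cancel_left, smul_smul]
  beta_reduce
  rw [hq]
  have haβ : β - δ ≤ dist a (x + β • n) := by
    have h1 := hball y hy
    have h2 := dist_triangle y a (x + β • n)
    linarith
  rw [hpn] at hap
  rcases dist_add_smul_le_or hn (hε.trans hεr) (sub_nonneg.2 hδβ) (mul_nonneg hθ0 hpos.le)
    (mul_le_of_le_one_left hpos.le hθ1) hpβ hap haβ hbx hr with h | h
  · exact ⟨a, ha, h⟩
  · exact ⟨b, hb, h⟩

/-- The conclusion amounts to `(2r - (β + ε))² ≤ 2(β - δ)² - (β + ε)²`; the bound on `ε + √2 δ`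
makes the right side nonnegative, so the square root is genuine. -/
theorem sq_add_sq_le_of_mem_Icc (hβ : 0 < β) (hε : 0 ≤ ε) (hεδ : ε + √2 * δ ≤ (√2 - 1) * β)
    (hr : r ∈ Set.Icc (1 / 2 * (β + ε - √(2 * (β - δ) ^ 2 - (β + ε) ^ 2)))
      (1 / 2 * (β + ε + √(2 * (β - δ) ^ 2 - (β + ε) ^ 2)))) :
    r ^ 2 + (β + ε - r) ^ 2 ≤ (β - δ) ^ 2 := by
  have h2 : √2 ^ 2 = 2 := Real.sq_sqrt (by norm_num)
  have h1 : (β + ε) ^ 2 ≤ (√2 * (β - δ)) ^ 2 := by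
    have : 0 ≤ β + ε := by linarith
    gcongr
    linarith
  rw [mul_pow, h2] at h1
  have h3 := Real.sq_sqrt (sub_nonneg.2 h1)
  set c := √(2 * (β - δ) ^ 2 - (β + ε) ^ 2)
  have h4 : (2 * r - (β + ε)) ^ 2 ≤ c ^ 2 :=
    sq_le_sq' (by linarith [hr.1]) (by linarith [hr.2])
  nlinarith

end Covering

theorem mainTheorem6 {d : ℕ} (X A : Set (EuclideanSpace ℝ (Fin d))) (hX : IsClosed X)
    (hreach : 0 < reach X) (β ε δ : ℝ) (hβ : 0 < β) (hβX : ENNReal.ofReal β < reach X)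
    (hε : 0 ≤ ε) (hεβ : ε < β) (hδ : 0 ≤ δ) (hδβ : δ < β)
    (hAX : A ⊆ closedThickening δ X) (hXA : X ⊆ closedThickening ε A)
    (hεδ : ε + √2 * δ ≤ (√2 - 1) * β)
    (r : ℝ)
    (hr : r ∈ Set.Icc (1 / 2 * (β + ε - √(2 * (β - δ) ^ 2 - (β + ε) ^ 2)))
      (1 / 2 * (β + ε + √(2 * (β - δ) ^ 2 - (β + ε) ^ 2))))
    (k : ℝ≥0) (g : closedThickening r A → ℝ) (hg : LipschitzWith k g) :
    ∃ hXr : X ⊆ closedThickening r A,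
      rSpaceDist (reebMap ⟨g, hg.continuous⟩)
        (reebMap ⟨fun x : X => g (Set.inclusion hXr x),
          hg.continuous.comp (continuous_inclusion hXr)⟩) ≤
      ENNReal.ofReal (k * (r + δ)) := by
  have hsq := sq_add_sq_le_of_mem_Icc hβ hε hεδ hr
  have hrβ : r + δ ≤ β := by
    have := abs_le_of_sq_le_sq' (show r ^ 2 ≤ (β - δ) ^ 2 by nlinarith [sq_nonneg (β + ε - r)])
      (by linarith)
    linarith [this.2]
  have hεr : ε ≤ r := by
    by_contra! hlt
    have h1 : β ^ 2 < (β + ε - r) ^ 2 := by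
      gcongr
      linarith
    have h2 : (β - δ) ^ 2 ≤ β ^ 2 := by
      have : 0 ≤ β - δ := by linarith
      gcongr
      linarith
    nlinarith [sq_nonneg r]
  have hXr : X ⊆ closedThickening r A := hXA.trans (closedThickening_mono A hεr)
  refine ⟨hXr, ?_⟩
  -- `X` may be empty, but then so are `A` and its thickening.
  have hne (p : closedThickening r A) : X.Nonempty := by
    obtain ⟨a, ha, -⟩ := p.2
    obtain ⟨y, hy, -⟩ := hAX ha
    exact ⟨y, hy⟩
  have hdist (p : closedThickening r A) : Metric.infDist p.1 X ≤ r + δ :=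
    infDist_le_of_mem_closedThickening hAX p.2
  let φ : C(closedThickening r A, X) :=
    ⟨fun p => ⟨nearestPoint X p.1, (nearestPoint_spec hX (hne p) p.1).1⟩,
      (continuous_iff_continuousAt.2 fun p =>
        (continuousAt_nearestPoint hX (hne p) (mem_uniqueNearest_of_infDist_le hX (hne p) hβX
          ((hdist p).trans hrβ))).comp continuousAt_subtype_val).subtype_mk _⟩
  let ψ : C(X, closedThickening r A) := ⟨Set.inclusion hXr, continuous_inclusion hXr⟩
  have hseg (p : closedThickening r A) :
      segment ℝ (nearestPoint X p.1) p.1 ⊆ closedThickening r A :=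
    segment_nearestPoint_subset hX (fun q hq => mem_uniqueNearest_of_infDist_le hX (hne p) hβX hq.le)
      hε hδβ.le hAX hXA hεr hrβ hsq p.2
  have hvar (p z : closedThickening r A) (hz : z.1 ∈ segment ℝ (nearestPoint X p.1) p.1) :
      |g z - g p| ≤ k * (r + δ) := by
    have h1 := hg.dist_le_mul z p
    rw [Real.dist_eq] at h1
    refine h1.trans ?_
    gcongr
    have h2 : dist z.1 p.1 ≤ dist (nearestPoint X p.1) p.1 :=
      (convex_closedBall p.1 (dist (nearestPoint X p.1) p.1)).segment_subset
        (Metric.mem_closedBall.2 le_rfl) (Metric.mem_closedBall_self dist_nonneg) hz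
    rw [dist_comm _ p.1, dist_comm _ p.1, ← (nearestPoint_spec hX (hne p) p.1).2] at h2
    rw [dist_comm]
    exact h2.trans (hdist p)
  have hs : 0 ≤ k * (r + δ) := by
    have : 0 ≤ r + δ := by linarith
    positivity
  have hcoe : ((k * (r + δ)).toNNReal : ℝ) = k * (r + δ) := Real.coe_toNNReal _ hs
  refine rSpaceDist_reebMap_le (reebInterleaving _ _ (k * (r + δ)).toNNReal φ ψ ?_ ?_ ?_ ?_)
  · intro p
    rw [hcoe]
    exact hvar p _ (left_mem_segment ℝ _ _)
  · intro x
    simp [ψ]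
  · intro p
    refine ⟨(↑) ⁻¹' segment ℝ (nearestPoint X p.1) p.1, ?_, right_mem_segment ℝ _ _,
      left_mem_segment ℝ _ _, fun z hz => ?_⟩
    · rw [← Topology.IsInducing.subtypeVal.isPreconnected_image, Subtype.image_preimage_coe,
        Set.inter_eq_right.2 (hseg p)]
      exact (convex_segment _ _).isPreconnected
    · rw [hcoe]
      exact hvar p z hz
  · intro x
    -- Projection fixes `X`, so a single point serves as the connected set.
    refine ⟨{x}, isPreconnected_singleton, rfl, Subtype.ext (nearestPoint_of_mem hX x.2), ?_⟩
    rintro _ rfl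
    simp
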